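/- Let $N$ be a non-negative integer and let $A, B \in \mathbb{C}^{N\times N}$ be anti-Hermitian matrices, i.e. $A^\dagger = -A$ and $B^\dagger = -B$. Let $\mathcal{L}(\{A,B\})$ denote the real Lie algebra generated by $A$ and $B$, i.e. the smallest real linear subspace of $\mathbb{C}^{N\times N}$ that contains $A$ and $B$ and is closed under the commutator $[X,Y] = XY - YX$, and let $\|X\|_F = \sqrt{\operatorname{tr}(X^\dagger X)}$ be the Frobenius norm. Then there exists an anti-Hermitian matrix $C \in \mathbb{C}^{N\times N}$ such that $$e^{C} = e^{A}e^{B}, \qquad C \in \mathcal{L}(\{A,B\}), \qquad \|C\|_F \le \|A\|_F + \|B\|_F .$$ -/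

import Mathlib

open scoped Matrix

-- The norm `‖X‖` of a complex matrix is the Frobenius norm.
attribute [local instance] Matrix.frobeniusNormedAddCommGroup

-- The Lie bracket of matrices is the commutator `X * Y - Y * X`.
attribute [local instance 100] LieRing.ofAssociativeRing

/-!
Consider the factorisations of `e^A e^B` into factors `e^{w_i Y_i}`, taken in a fixed order, with
fixed short durations `w_i > 0` and velocities `Y_i` in the Lie algebra `L` generated by `A` and
`B`. As `L` is finite-dimensional, the energy `∑ w_i ‖Y_i‖²` of such a broken geodesic attains its
minimum. The form `(X, Y) ↦ -Re tr (X Y)` induces the norm of `L` and is invariant under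
conjugation, which gives Gauss's lemma `tr (X · e^{-X} dexp_X V) = tr (X V)` and with it the first
variation of the energy: it strictly decreases when the break point between two pieces of different
velocity is moved suitably. So all velocities of a minimiser agree with a single `V`, and
`e^A e^B = e^{TV}` for the total duration `T`. Running the one-parameter groups of `A` and `B` at
unit speed gives a competitor of duration and energy `T = ‖A‖ + ‖B‖`; hence `‖V‖ ≤ 1`, and `C = TV`
satisfies the bound.
-/

open Filter Function NormedSpace Set Topology

section Exponential

variable {𝔸 : Type*} [NormedRing 𝔸] [NormedAlgebra ℝ 𝔸] [CompleteSpace 𝔸]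

theorem contDiff_exp_of_real {n : WithTop ℕ∞} : ContDiff ℝ n (exp : 𝔸 → 𝔸) :=
  contDiff_iff_contDiffAt.2 fun x => (exp_analytic (𝕂 := ℝ) x).contDiffAt

@[fun_prop]
theorem continuous_exp_of_real : Continuous (exp : 𝔸 → 𝔸) :=
  (contDiff_exp_of_real (n := 0)).continuous

theorem exp_smul_mul_exp_smul (s t : ℝ) (x : 𝔸) :
    exp (s • x) * exp (t • x) = exp ((s + t) • x) := by
  let := NormedAlgebra.restrictScalars ℚ ℝ 𝔸
  rw [add_smul, exp_add_of_commute (((Commute.refl x).smul_left s).smul_right t)]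

theorem exp_mul_exp_neg (x : 𝔸) : exp x * exp (-x) = 1 := by
  simpa using exp_smul_mul_exp_smul 1 (-1) x

theorem exp_neg_mul_exp (x : 𝔸) : exp (-x) * exp x = 1 := by
  simpa using exp_mul_exp_neg (-x)

theorem exp_neg_eq_of_exp_mul_eq_one {x y : 𝔸} (h : exp x * y = 1) : exp (-x) = y :=
  left_inv_eq_right_inv (exp_neg_mul_exp x) h

theorem exp_inv_natCast_smul_pow {m : ℕ} (hm : m ≠ 0) (x : 𝔸) :
    exp ((m : ℝ)⁻¹ • x) ^ m = exp x := by
  let := NormedAlgebra.restrictScalars ℚ ℝ 𝔸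
  rw [← exp_nsmul, ← Nat.cast_smul_eq_nsmul ℝ, smul_inv_smul₀ (Nat.cast_ne_zero.2 hm)]

theorem hasDerivAt_exp_one_sub_smul_mul_exp_smul (a b : 𝔸) (s : ℝ) :
    HasDerivAt (fun s : ℝ => exp ((1 - s) • a) * exp (s • b))
      (exp ((1 - s) • a) * (b - a) * exp (s • b)) s := by
  have ha : HasDerivAt (fun s : ℝ => exp ((1 - s) • a)) (-(exp ((1 - s) • a) * a)) s := by
    simpa [Function.comp_def] using
      (hasDerivAt_exp_smul_const a (1 - s)).scomp s ((hasDerivAt_id s).const_sub 1)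
  refine (ha.mul (hasDerivAt_exp_smul_const' b s)).congr_deriv ?_
  noncomm_ring

theorem exp_sub_exp_eq_integral (a b : 𝔸) :
    exp b - exp a = ∫ s in (0 : ℝ)..1, exp ((1 - s) • a) * (b - a) * exp (s • b) := by
  have hcont : Continuous fun s : ℝ => exp ((1 - s) • a) * (b - a) * exp (s • b) := by fun_prop
  rw [intervalIntegral.integral_eq_sub_of_hasDerivAt
    (fun s _ => hasDerivAt_exp_one_sub_smul_mul_exp_smul a b s) (hcont.intervalIntegrable _ _)]
  simp

theorem hasDerivAt_exp_add_smul (X V : 𝔸) :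
    HasDerivAt (fun u : ℝ => exp (X + u • V))
      (∫ s in (0 : ℝ)..1, exp ((1 - s) • X) * V * exp (s • X)) 0 := by
  have hcont : Continuous fun u : ℝ =>
      ∫ s in (0 : ℝ)..1, exp ((1 - s) • X) * V * exp (s • (X + u • V)) := by
    apply intervalIntegral.continuous_parametric_intervalIntegral_of_continuous'
    fun_prop
  have hlim := hcont.tendsto 0
  simp only [zero_smul, add_zero] at hlim
  rw [hasDerivAt_iff_tendsto_slope]
  refine (hlim.mono_left nhdsWithin_le_nhds).congr' ?_
  filter_upwards [self_mem_nhdsWithin] with u hu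
  rw [slope_def_module, zero_smul, add_zero, exp_sub_exp_eq_integral,
    ← intervalIntegral.integral_smul]
  simp [smul_smul, inv_mul_cancel₀ hu]

theorem fderiv_exp_apply_eq_integral (X V : 𝔸) :
    fderiv ℝ exp X V = ∫ s in (0 : ℝ)..1, exp ((1 - s) • X) * V * exp (s • X) := by
  have hline : HasDerivAt (fun u : ℝ => X + u • V) V 0 := by
    simpa using ((hasDerivAt_id (0 : ℝ)).smul_const V).const_add X
  have hexp : HasFDerivAt exp (fderiv ℝ exp X) (X + (0 : ℝ) • V) := by
    simpa using ((contDiff_exp_of_real (n := 1)).differentiable one_ne_zero X).hasFDerivAt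
  exact (hexp.comp_hasDerivAt 0 hline).unique (hasDerivAt_exp_add_smul X V)

/-- The differential of the exponential at `X`, translated back to the identity by left
multiplication with `exp (-X)`; this is the operator `(1 - e^{-ad X}) / ad X`. -/
noncomputable def expDifferential (X : 𝔸) : 𝔸 →L[ℝ] 𝔸 :=
  (ContinuousLinearMap.mul ℝ 𝔸 (exp (-X))).comp (fderiv ℝ exp X)

theorem exp_mul_expDifferential (X V : 𝔸) :
    exp X * expDifferential X V = fderiv ℝ exp X V := by
  simp [expDifferential, ← mul_assoc, exp_mul_exp_neg]

theorem expDifferential_zero : expDifferential (0 : 𝔸) = 1 := by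
  ext V
  simp [expDifferential, (hasFDerivAt_exp_zero (𝕂 := ℝ) (𝔸 := 𝔸)).fderiv]

theorem contDiff_expDifferential {n : WithTop ℕ∞} :
    ContDiff ℝ n (expDifferential : 𝔸 → 𝔸 →L[ℝ] 𝔸) :=
  ((ContinuousLinearMap.mul ℝ 𝔸).contDiff.comp
    (contDiff_exp_of_real.comp contDiff_neg)).clm_comp
    (contDiff_exp_of_real.fderiv_right le_rfl)

theorem continuous_exp_neg_smul_mul_mul_exp_smul (X V : 𝔸) :
    Continuous fun s : ℝ => exp (-(s • X)) * V * exp (s • X) := by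
  fun_prop

theorem expDifferential_apply_eq_integral (X V : 𝔸) :
    expDifferential X V = ∫ s in (0 : ℝ)..1, exp (-(s • X)) * V * exp (s • X) := by
  have hcont : Continuous fun s : ℝ => exp ((1 - s) • X) * V * exp (s • X) := by fun_prop
  have hshift (s : ℝ) : exp (-X) * exp ((1 - s) • X) = exp (-(s • X)) := by
    rw [← neg_one_smul ℝ X, exp_smul_mul_exp_smul]
    congr 1
    module
  calc expDifferential X V
      = exp (-X) * ∫ s in (0 : ℝ)..1, exp ((1 - s) • X) * V * exp (s • X) := by
        rw [← fderiv_exp_apply_eq_integral]; rfl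
    _ = ∫ s in (0 : ℝ)..1, exp (-X) * (exp ((1 - s) • X) * V * exp (s • X)) :=
        ((ContinuousLinearMap.mul ℝ 𝔸 (exp (-X))).intervalIntegral_comp_comm
          (hcont.intervalIntegrable 0 1)).symm
    _ = ∫ s in (0 : ℝ)..1, exp (-(s • X)) * V * exp (s • X) := by
        simp only [← mul_assoc, hshift]

theorem map_mul_expDifferential {τ : 𝔸 →L[ℝ] ℝ} (hτ : ∀ x y, τ (x * y) = τ (y * x)) (X V : 𝔸) :
    τ (X * expDifferential X V) = τ (X * V) := by
  have hconj (s : ℝ) : τ (X * (exp (-(s • X)) * V * exp (s • X))) = τ (X * V) := by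
    have hcomm : Commute (exp (s • X)) X := ((Commute.refl X).smul_left s).exp_left
    calc τ (X * (exp (-(s • X)) * V * exp (s • X)))
        = τ (exp (s • X) * X * (exp (-(s • X)) * V)) := by rw [← mul_assoc, hτ, ← mul_assoc]
      _ = τ (X * (exp (s • X) * exp (-(s • X))) * V) := by rw [hcomm.eq]; simp only [mul_assoc]
      _ = τ (X * V) := by rw [exp_mul_exp_neg, mul_one]
  have hint := (τ.comp (ContinuousLinearMap.mul ℝ 𝔸 X)).intervalIntegral_comp_comm
    ((continuous_exp_neg_smul_mul_mul_exp_smul X V).intervalIntegrable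
      (μ := MeasureTheory.volume) 0 1)
  simp only [ContinuousLinearMap.comp_apply, ContinuousLinearMap.mul_apply', hconj] at hint
  rw [expDifferential_apply_eq_integral, ← hint]
  simp

theorem eventually_exp_eq_exp_mul_exp_smul {Z : ℝ → 𝔸} {W : 𝔸}
    (hZ : ∀ᶠ t in 𝓝 0, ∃ V, HasDerivAt Z V t ∧ expDifferential (Z t) V = W) :
    ∀ᶠ t in 𝓝 (0 : ℝ), exp (Z t) = exp (Z 0) * exp (t • W) := by
  obtain ⟨δ, hδ, hball⟩ := Metric.eventually_nhds_iff_ball.1 hZ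
  have hderiv : ∀ t ∈ Metric.ball (0 : ℝ) δ,
      HasDerivAt (fun t => exp (Z t) * exp (t • -W)) 0 t := by
    intro t ht
    obtain ⟨V, hV, hVW⟩ := hball t ht
    have hexp : HasDerivAt (fun t => exp (Z t)) (exp (Z t) * W) t := by
      rw [← hVW, exp_mul_expDifferential]
      exact ((contDiff_exp_of_real (n := 1)).differentiable one_ne_zero
        (Z t)).hasFDerivAt.comp_hasDerivAt t hV
    refine (hexp.mul (hasDerivAt_exp_smul_const' (-W) t)).congr_deriv ?_
    noncomm_ring
  filter_upwards [Metric.ball_mem_nhds (0 : ℝ) hδ] with t ht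
  have hconst : exp (Z t) * exp (t • -W) = exp (Z 0) := by
    simpa using Metric.isOpen_ball.is_const_of_deriv_eq_zero
      (convex_ball (0 : ℝ) δ).isPreconnected
      (fun t ht => (hderiv t ht).differentiableAt.differentiableWithinAt)
      (fun t ht => (hderiv t ht).deriv) ht (Metric.mem_ball_self hδ)
  rw [← hconst, mul_assoc, smul_neg, exp_neg_mul_exp, mul_one]

end Exponential

section LieSubalgebra

variable {𝔸 : Type*} [NormedRing 𝔸] [NormedAlgebra ℝ 𝔸]

/-- The adjoint operator `V ↦ ⁅X, V⁆` of a normed algebra as a bounded operator, so that it can be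
exponentiated. -/
noncomputable def continuousAd (X : 𝔸) : 𝔸 →L[ℝ] 𝔸 :=
  ContinuousLinearMap.mul ℝ 𝔸 X - (ContinuousLinearMap.mul ℝ 𝔸).flip X

theorem continuousAd_apply (X V : 𝔸) : continuousAd X V = ⁅X, V⁆ :=
  rfl

variable [CompleteSpace 𝔸]

theorem exp_continuousAd_apply (X V : 𝔸) : exp (continuousAd X) V = exp X * V * exp (-X) := by
  have hderiv (t : ℝ) : HasDerivAt
      (fun t : ℝ => exp (t • -X) * exp (t • continuousAd X) V * exp (t • X)) 0 t := by
    have hAd : HasDerivAt (fun t : ℝ => exp (t • continuousAd X) V)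
        (continuousAd X (exp (t • continuousAd X) V)) t :=
      (ContinuousLinearMap.apply ℝ 𝔸 V).hasFDerivAt.comp_hasDerivAt t
        (hasDerivAt_exp_smul_const' (continuousAd X) t)
    refine (((hasDerivAt_exp_smul_const (-X) t).mul hAd).mul
      (hasDerivAt_exp_smul_const' X t)).congr_deriv ?_
    simp only [continuousAd_apply, Ring.lie_def, Pi.mul_apply]
    noncomm_ring
  have hconst : exp (-X) * exp (continuousAd X) V * exp X = V := by
    have hzero : (0 : ℝ) • continuousAd X = 0 := zero_smul ℝ (continuousAd X)
    have hone : (1 : ℝ) • continuousAd X = continuousAd X := one_smul ℝ (continuousAd X)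
    simpa [hzero, hone] using is_const_of_deriv_eq_zero (fun t => (hderiv t).differentiableAt)
      (fun t => (hderiv t).deriv) 1 0
  calc exp (continuousAd X) V
      = exp X * exp (-X) * exp (continuousAd X) V * (exp X * exp (-X)) := by
        simp [exp_mul_exp_neg]
    _ = exp X * (exp (-X) * exp (continuousAd X) V * exp X) * exp (-X) := by
        simp only [mul_assoc]
    _ = exp X * V * exp (-X) := by rw [hconst]

variable {L : LieSubalgebra ℝ 𝔸}

theorem exp_mul_mul_exp_neg_mem (hL : IsClosed (L : Set 𝔸)) {X V : 𝔸} (hX : X ∈ L)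
    (hV : V ∈ L) : exp X * V * exp (-X) ∈ L := by
  have hpow (k : ℕ) : (continuousAd X ^ k) V ∈ L := by
    induction k with
    | zero => simpa
    | succ k ih =>
      rw [pow_succ', mul_apply_eq_comp, continuousAd_apply]
      exact L.lie_mem hX ih
  have hsum := (exp_series_hasSum_exp' (𝕂 := ℝ) (continuousAd X)).mapL
    (ContinuousLinearMap.apply ℝ 𝔸 V)
  rw [← exp_continuousAd_apply]
  exact hL.mem_of_tendsto hsum (Eventually.of_forall fun s =>
    sum_mem fun k _ => L.smul_mem _ (hpow k))

theorem expDifferential_mem (hL : IsClosed (L : Set 𝔸)) {X V : 𝔸} (hX : X ∈ L) (hV : V ∈ L) :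
    expDifferential X V ∈ L := by
  have : MeasureTheory.IsProbabilityMeasure
      (MeasureTheory.volume.restrict (Ioc (0 : ℝ) 1)) := ⟨by simp⟩
  rw [expDifferential_apply_eq_integral, intervalIntegral.integral_of_le zero_le_one]
  refine L.toSubmodule.convex.integral_mem hL (Eventually.of_forall fun s => ?_)
    ((continuous_exp_neg_smul_mul_mul_exp_smul X V).integrableOn_Ioc)
  simpa using exp_mul_mul_exp_neg_mem hL (L.neg_mem (L.smul_mem s hX)) hV

variable [FiniteDimensional ℝ L]

/-- The restriction of `expDifferential X` to a finite-dimensional Lie subalgebra containing `X`;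
finite-dimensionality is what makes the subalgebra closed. -/
noncomputable def lieExpDifferential (X : L) : L →L[ℝ] L :=
  ((expDifferential (X : 𝔸)).comp L.toSubmodule.subtypeL).codRestrict L.toSubmodule fun V =>
    expDifferential_mem L.toSubmodule.closed_of_finiteDimensional X.2 V.2

theorem coe_lieExpDifferential_apply (X V : L) :
    (lieExpDifferential X V : 𝔸) = expDifferential (X : 𝔸) V :=
  rfl

theorem lieExpDifferential_zero : lieExpDifferential (0 : L) = 1 := by
  ext V
  simp [coe_lieExpDifferential_apply, expDifferential_zero]

theorem contDiff_lieExpDifferential {n : WithTop ℕ∞} :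
    ContDiff ℝ n (lieExpDifferential : L → L →L[ℝ] L) := by
  obtain ⟨P, hP⟩ := Submodule.ClosedComplemented.of_finiteDimensional L.toSubmodule
  have hproj : (lieExpDifferential : L → L →L[ℝ] L) = fun X : L =>
      P.comp ((expDifferential (X : 𝔸)).comp L.toSubmodule.subtypeL) :=
    funext fun X => ContinuousLinearMap.ext fun V => (hP (lieExpDifferential X V)).symm
  rw [hproj]
  exact contDiff_const.clm_comp
    ((contDiff_expDifferential.comp L.toSubmodule.subtypeL.contDiff).clm_comp contDiff_const)

theorem isOpen_setOf_isUnit_lieExpDifferential :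
    IsOpen {X : L | IsUnit (lieExpDifferential X)} :=
  have := FiniteDimensional.complete ℝ L
  (Units.isOpen (R := L →L[ℝ] L)).preimage
    (contDiff_lieExpDifferential (L := L) (n := 0)).continuous

theorem exists_pos_forall_isUnit_lieExpDifferential (L : LieSubalgebra ℝ 𝔸)
    [FiniteDimensional ℝ L] :
    ∃ ε > 0, ∀ X : L, ‖X‖ < ε → IsUnit (lieExpDifferential X) := by
  have hunit : IsUnit (lieExpDifferential (0 : L)) := lieExpDifferential_zero (L := L) ▸ isUnit_one
  obtain ⟨ε, hε, hball⟩ :=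
    Metric.isOpen_iff.1 (isOpen_setOf_isUnit_lieExpDifferential (L := L)) 0 hunit
  exact ⟨ε, hε, fun X hX => hball (mem_ball_zero_iff.2 hX)⟩

theorem exists_hasDerivAt_lieExpDifferential_eq {X : L} (hX : IsUnit (lieExpDifferential X))
    (W : L) :
    ∃ Z : ℝ → L, Z 0 = X ∧
      ∀ᶠ t in 𝓝 0, ∃ V, HasDerivAt Z V t ∧ lieExpDifferential (Z t) V = W := by
  have := FiniteDimensional.complete ℝ L
  have hfield : ContDiffAt ℝ 1 (fun Y : L => Ring.inverse (lieExpDifferential Y) W) X := by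
    have hinv : ContDiffAt ℝ 1 (Ring.inverse : (L →L[ℝ] L) → L →L[ℝ] L)
        (lieExpDifferential X) := by
      obtain ⟨u, hu⟩ := hX
      rw [← hu]
      exact contDiffAt_ringInverse (R := L →L[ℝ] L) ℝ u
    exact (hinv.comp X contDiff_lieExpDifferential.contDiffAt).clm_apply contDiffAt_const
  obtain ⟨Z, hZ₀, ε, hε, hZ⟩ :=
    hfield.exists_forall_mem_closedBall_exists_eq_forall_mem_Ioo_hasDerivAt₀ 0
  simp only [zero_sub, zero_add] at hZ
  have hunit : ∀ᶠ t in 𝓝 0, IsUnit (lieExpDifferential (Z t)) :=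
    (hZ 0 ⟨neg_lt_zero.2 hε, hε⟩).continuousAt.eventually_mem
      (isOpen_setOf_isUnit_lieExpDifferential.mem_nhds (hZ₀ ▸ hX))
  refine ⟨Z, hZ₀, ?_⟩
  filter_upwards [hunit, Ioo_mem_nhds (neg_lt_zero.2 hε) hε] with t ht htε
  refine ⟨_, hZ t htε, ?_⟩
  rw [← mul_apply_eq_comp, Ring.mul_inverse_cancel _ ht, one_apply_eq_self]

/-- A trace on `𝔸`, thought of as `x ↦ re (tr x)`, that induces the norm of `L` through
`‖x‖² = -τ (x²)`; the sign is the one for skew-adjoint elements. -/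
structure IsNormTraceOn (L : LieSubalgebra ℝ 𝔸) (τ : 𝔸 →L[ℝ] ℝ) : Prop where
  map_mul_comm : ∀ x y, τ (x * y) = τ (y * x)
  norm_sq : ∀ x ∈ L, ‖x‖ ^ 2 = -τ (x * x)

variable {τ : 𝔸 →L[ℝ] ℝ}

omit [CompleteSpace 𝔸] [FiniteDimensional ℝ L] in
theorem IsNormTraceOn.hasDerivAt_norm_sq (hτ : IsNormTraceOn L τ) {Z : ℝ → L} {V : L} {t : ℝ}
    (hZ : HasDerivAt Z V t) :
    HasDerivAt (fun t => ‖Z t‖ ^ 2) (-2 * τ (Z t * V)) t := by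
  have hcoe : HasDerivAt (fun t => (Z t : 𝔸)) (V : 𝔸) t :=
    L.toSubmodule.subtypeL.hasFDerivAt.comp_hasDerivAt t hZ
  have hnorm : (fun t => ‖Z t‖ ^ 2) = fun t => -τ (Z t * Z t) :=
    funext fun t => hτ.norm_sq _ (Z t).2
  rw [hnorm]
  refine (τ.hasFDerivAt.comp_hasDerivAt t (hcoe.mul hcoe)).neg.congr_deriv ?_
  rw [map_add, hτ.map_mul_comm V]
  ring

theorem IsNormTraceOn.exists_variation (hτ : IsNormTraceOn L τ) {X : L}
    (hX : IsUnit (lieExpDifferential X)) (W : L) :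
    ∃ Z : ℝ → L, Z 0 = X ∧
      (∀ᶠ t in 𝓝 (0 : ℝ), exp (Z t : 𝔸) = exp (X : 𝔸) * exp (t • (W : 𝔸))) ∧
      HasDerivAt (fun t => ‖Z t‖ ^ 2) (-2 * τ (X * W)) 0 := by
  obtain ⟨Z, rfl, hZ⟩ := exists_hasDerivAt_lieExpDifferential_eq hX W
  refine ⟨Z, rfl, eventually_exp_eq_exp_mul_exp_smul (hZ.mono ?_), ?_⟩
  · rintro t ⟨V, hV, hVW⟩
    exact ⟨V, L.toSubmodule.subtypeL.hasFDerivAt.comp_hasDerivAt t hV, congrArg Subtype.val hVW⟩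
  · obtain ⟨V, hV, rfl⟩ := hZ.self_of_nhds
    rw [coe_lieExpDifferential_apply, map_mul_expDifferential hτ.map_mul_comm]
    exact hτ.hasDerivAt_norm_sq hV

/-- The break point between the two pieces is moved in the direction `Y - X`, along which the energy
has derivative `-2 * ‖Y - X‖ ^ 2`. -/
theorem IsNormTraceOn.exists_pair_energy_lt (hτ : IsNormTraceOn L τ) {a b : ℝ} (ha : 0 < a)
    (hb : 0 < b) {X Y : L} (hX : IsUnit (lieExpDifferential (a • X)))
    (hY : IsUnit (lieExpDifferential (-(b • Y)))) (hXY : X ≠ Y) :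
    ∃ X' Y' : L,
      exp ((a • X' : L) : 𝔸) * exp ((b • Y' : L) : 𝔸) =
        exp ((a • X : L) : 𝔸) * exp ((b • Y : L) : 𝔸) ∧
      a * ‖X'‖ ^ 2 + b * ‖Y'‖ ^ 2 < a * ‖X‖ ^ 2 + b * ‖Y‖ ^ 2 := by
  by_contra! hmin
  obtain ⟨Z₁, hZ₁, hexp₁, hderiv₁⟩ := hτ.exists_variation hX (Y - X)
  obtain ⟨Z₂, hZ₂, hexp₂, hderiv₂⟩ := hτ.exists_variation hY (Y - X)
  let E : ℝ → ℝ := fun t => ‖Z₁ t‖ ^ 2 / a + ‖Z₂ t‖ ^ 2 / b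
  have henergy (t : ℝ) : E t = a * ‖a⁻¹ • Z₁ t‖ ^ 2 + b * ‖-(b⁻¹ • Z₂ t)‖ ^ 2 := by
    simp only [E, norm_neg, norm_smul, mul_pow, norm_inv, Real.norm_of_nonneg, ha.le, hb.le]
    field_simp
  have hlocmin : IsLocalMin E 0 := by
    filter_upwards [hexp₁, hexp₂] with t h₁ h₂
    have hneg : exp (-(Z₂ t : 𝔸)) =
        exp (-(t • ((Y - X : L) : 𝔸))) * exp ((b • Y : L) : 𝔸) := by
      apply exp_neg_eq_of_exp_mul_eq_one
      rw [h₂, mul_assoc, ← mul_assoc (exp (t • _)), exp_mul_exp_neg, one_mul,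
        NegMemClass.coe_neg, exp_neg_mul_exp]
    have hprod : exp (Z₁ t : 𝔸) * exp (-(Z₂ t : 𝔸)) =
        exp ((a • X : L) : 𝔸) * exp ((b • Y : L) : 𝔸) := by
      rw [h₁, hneg, mul_assoc, ← mul_assoc (exp (t • _)), exp_mul_exp_neg, one_mul]
    have hle := hmin (a⁻¹ • Z₁ t) (-(b⁻¹ • Z₂ t)) (by
      rwa [smul_neg, smul_inv_smul₀ ha.ne', smul_inv_smul₀ hb.ne', NegMemClass.coe_neg])
    rw [henergy, henergy, hZ₁, hZ₂, inv_smul_smul₀ ha.ne', smul_neg, inv_smul_smul₀ hb.ne',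
      neg_neg]
    exact hle
  have hcrit := hlocmin.hasDerivAt_eq_zero ((hderiv₁.div_const a).add (hderiv₂.div_const b))
  have hdir : τ ((Y : 𝔸) * (Y - X : L)) - τ ((X : 𝔸) * (Y - X : L)) = 0 := by
    simp only [NegMemClass.coe_neg, SetLike.val_smul, neg_mul, smul_mul_assoc, map_neg, map_smul,
      smul_eq_mul] at hcrit
    field_simp at hcrit
    linarith
  have hnorm : ‖Y - X‖ ^ 2 = 0 := by
    rw [AddSubgroupClass.coe_norm, hτ.norm_sq _ (Y - X).2]
    nth_rw 1 [AddSubgroupClass.coe_sub]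
    rw [sub_mul, map_sub, hdir, neg_zero]
  exact hXY (sub_eq_zero.1 (norm_eq_zero.1 (sq_eq_zero_iff.1 hnorm))).symm

end LieSubalgebra

section BrokenGeodesic

variable {ι : Type*} {w : ι → ℝ} {l : List ι}

/-- The energy of a broken geodesic whose pieces, taken in the order `l`, have velocity `Y i` for
the duration `w i`. -/
def energy {E : Type*} [Norm E] (w : ι → ℝ) (l : List ι) (Y : ι → E) : ℝ :=
  (l.map fun i => w i * ‖Y i‖ ^ 2).sum

section Energy

variable {E : Type*} [SeminormedAddCommGroup E]

theorem continuous_energy (w : ι → ℝ) (l : List ι) :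
    Continuous (energy w l : (ι → E) → ℝ) :=
  continuous_list_sum l fun i _ => by fun_prop

theorem mul_norm_sq_le_energy (hw : ∀ i, 0 ≤ w i) {i : ι} (hi : i ∈ l) (Y : ι → E) :
    w i * ‖Y i‖ ^ 2 ≤ energy w l Y := by
  refine List.single_le_sum ?_ _ (List.mem_map_of_mem hi)
  simp only [List.mem_map, forall_exists_index, and_imp, forall_apply_eq_imp_iff₂]
  exact fun j _ => mul_nonneg (hw j) (sq_nonneg _)

theorem norm_le_sqrt_energy_div (hw : ∀ i, 0 < w i) {i : ι} (hi : i ∈ l) (Y : ι → E) :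
    ‖Y i‖ ≤ √(energy w l Y / w i) :=
  Real.le_sqrt_of_sq_le <|
    (le_div_iff₀' (hw i)).2 (mul_norm_sq_le_energy (fun j => (hw j).le) hi Y)

theorem energy_of_forall_eq {Y : ι → E} {V : E} (h : ∀ i ∈ l, Y i = V) :
    energy w l Y = (l.map w).sum * ‖V‖ ^ 2 := by
  rw [← List.sum_map_mul_right, energy]
  exact congrArg List.sum (List.map_congr_left fun i hi => by rw [h i hi])

end Energy

theorem map_update_update_of_nodup {α β : Type*} [DecidableEq ι] {l₁ l₂ : List ι} {i j : ι}
    (hl : (l₁ ++ i :: j :: l₂).Nodup) (f : ι → α → β) (Y : ι → α) (x y : α) :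
    (l₁ ++ i :: j :: l₂).map (fun k => f k (update (update Y i x) j y k)) =
      l₁.map (fun k => f k (Y k)) ++ f i x :: f j y :: l₂.map fun k => f k (Y k) := by
  simp only [List.nodup_append, List.nodup_cons, List.mem_cons] at hl
  have hcongr (l : List ι) (hi : i ∉ l) (hj : j ∉ l) :
      l.map (fun k => f k (update (update Y i x) j y k)) = l.map fun k => f k (Y k) := by
    refine List.map_congr_left fun k hk => ?_
    rw [update_of_ne (ne_of_mem_of_not_mem hk hj), update_of_ne (ne_of_mem_of_not_mem hk hi)]
  have hij : i ≠ j := by grind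
  rw [List.map_append, List.map_cons, List.map_cons, hcongr l₁ (by grind) (by grind),
    hcongr l₂ (by grind) (by grind), update_self, update_of_ne hij, update_self]

variable {𝔸 : Type*} [NormedRing 𝔸] [NormedAlgebra ℝ 𝔸] {L : LieSubalgebra ℝ 𝔸}

/-- The endpoint of the broken geodesic which issues from `1` and whose pieces, taken in the order
`l`, have left-translated velocity `Y i` for the duration `w i`. -/
noncomputable def expProd (w : ι → ℝ) (l : List ι) (Y : ι → L) : 𝔸 :=
  (l.map fun i => exp ((w i • Y i : L) : 𝔸)).prod

variable [CompleteSpace 𝔸]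

theorem continuous_expProd (w : ι → ℝ) (l : List ι) :
    Continuous (expProd w l : (ι → L) → 𝔸) :=
  continuous_list_prod l fun i _ => by fun_prop

theorem expProd_of_forall_eq {Y : ι → L} {V : L} (h : ∀ i ∈ l, Y i = V) :
    expProd w l Y = exp (((l.map w).sum • V : L) : 𝔸) := by
  induction l with
  | nil => simp [expProd]
  | cons i l ih =>
    have htail := ih fun j hj => h j (List.mem_cons_of_mem i hj)
    simp only [expProd, List.map_cons, List.prod_cons, List.sum_cons, SetLike.val_smul] at htail ⊢
    rw [htail, h i List.mem_cons_self, exp_smul_mul_exp_smul]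

variable [FiniteDimensional ℝ L]

theorem exists_energy_minimizer (hw : ∀ i, 0 < w i) (hl : ∀ i, i ∈ l)
    (Y₀ : ι → L) :
    ∃ Y : ι → L, expProd w l Y = expProd w l Y₀ ∧
      ∀ Z : ι → L, expProd w l Z = expProd w l Y₀ → energy w l Y ≤ energy w l Z := by
  have := FiniteDimensional.proper_real L
  have hclosed : IsClosed {Y : ι → L | expProd w l Y = expProd w l Y₀} :=
    isClosed_eq (continuous_expProd w l) continuous_const
  have hcompact : IsCompact
      (univ.pi fun i => Metric.closedBall (0 : L) √(energy w l Y₀ / w i)) :=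
    isCompact_univ_pi fun i => isCompact_closedBall _ _
  have hcoercive : ∀ᶠ Y : ι → L in cocompact (ι → L), energy w l Y₀ ≤ energy w l Y := by
    filter_upwards [hcompact.compl_mem_cocompact] with Y hY
    contrapose! hY
    refine notMem_compl_iff.2 fun i _ => mem_closedBall_zero_iff.2 ?_
    refine (norm_le_sqrt_energy_div hw (hl i) Y).trans (Real.sqrt_le_sqrt ?_)
    exact div_le_div_of_nonneg_right hY.le (hw i).le
  obtain ⟨Y, hY, hmin⟩ := (continuous_energy w l).continuousOn.exists_isMinOn' hclosed
    (x₀ := Y₀) rfl (hcoercive.filter_mono inf_le_left)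
  exact ⟨Y, hY, fun Z hZ => hmin hZ⟩

variable {τ : 𝔸 →L[ℝ] ℝ}

theorem IsNormTraceOn.pairwise_eq_of_energy_minimal (hτ : IsNormTraceOn L τ)
    (hw : ∀ i, 0 < w i) (hl : l.Nodup) {Y : ι → L}
    (hunit : ∀ i, IsUnit (lieExpDifferential (w i • Y i)))
    (hunit_neg : ∀ i, IsUnit (lieExpDifferential (-(w i • Y i))))
    (hmin : ∀ Z : ι → L, expProd w l Z = expProd w l Y → energy w l Y ≤ energy w l Z) :
    l.Pairwise fun i j => Y i = Y j := by
  classical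
  have : IsTrans ι fun i j => Y i = Y j := ⟨fun _ _ _ => Eq.trans⟩
  rw [← List.isChain_iff_pairwise, List.isChain_iff_forall_rel_of_append_cons_cons]
  rintro i j l₁ l₂ rfl
  by_contra hne
  obtain ⟨x, y, hprod, hlt⟩ :=
    hτ.exists_pair_energy_lt (hw i) (hw j) (hunit i) (hunit_neg j) hne
  refine (hmin (update (update Y i x) j y) ?_).not_gt ?_
  · rw [expProd, map_update_update_of_nodup hl fun k V => exp ((w k • V : L) : 𝔸)]
    simp only [expProd, List.map_append, List.map_cons, List.prod_append, List.prod_cons]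
    rw [← mul_assoc (exp _), hprod, mul_assoc]
  · rw [energy, map_update_update_of_nodup hl fun k V => w k * ‖V‖ ^ 2]
    simp only [energy, List.map_append, List.map_cons, List.sum_append, List.sum_cons]
    linarith

theorem IsNormTraceOn.exists_exp_eq_expProd (hτ : IsNormTraceOn L τ) {ε : ℝ}
    (hε : 0 < ε) (hunit : ∀ X : L, ‖X‖ < ε → IsUnit (lieExpDifferential X))
    (hw : ∀ i, 0 < w i) (hl : l.Nodup) (hmem : ∀ i, i ∈ l) {Y₀ : ι → L}
    (hY₀ : ∀ i, w i * energy w l Y₀ < ε ^ 2) :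
    ∃ V : L, exp (((l.map w).sum • V : L) : 𝔸) = expProd w l Y₀ ∧
      (l.map w).sum * ‖V‖ ^ 2 ≤ energy w l Y₀ := by
  obtain ⟨Y, hprod, hmin⟩ := exists_energy_minimizer hw hmem Y₀
  have hsmall (i : ι) : ‖w i • Y i‖ < ε := by
    refine lt_of_pow_lt_pow_left₀ 2 hε.le ?_
    calc ‖w i • Y i‖ ^ 2
        = w i * (w i * ‖Y i‖ ^ 2) := by
          rw [norm_smul, Real.norm_of_nonneg (hw i).le]; ring
      _ ≤ w i * energy w l Y₀ := by
          gcongr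
          · exact (hw i).le
          · exact (mul_norm_sq_le_energy (fun j => (hw j).le) (hmem i) Y).trans (hmin Y₀ rfl)
      _ < ε ^ 2 := hY₀ i
  have hpair : l.Pairwise fun i j => Y i = Y j :=
    hτ.pairwise_eq_of_energy_minimal hw hl (fun i => hunit _ (hsmall i))
      (fun i => hunit _ (by rw [norm_neg]; exact hsmall i)) fun Z hZ => hmin Z (hZ.trans hprod)
  obtain ⟨V, hV⟩ : ∃ V, ∀ i ∈ l, Y i = V := by
    cases hpair with
    | nil => exact ⟨0, by simp⟩
    | cons hhead _ => exact ⟨_, List.forall_mem_cons.2 ⟨rfl, fun j hj => (hhead j hj).symm⟩⟩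
  refine ⟨V, ?_, ?_⟩
  · rw [← expProd_of_forall_eq hV, hprod]
  · rw [← energy_of_forall_eq hV]
    exact hmin Y₀ rfl

omit [FiniteDimensional ℝ L] in
theorem exists_expProd_eq_exp_mul_exp {A B : L} (hA : A ≠ 0) (hB : B ≠ 0) {δ : ℝ} (hδ : 0 < δ) :
    ∃ (ι : Type) (w : ι → ℝ) (l : List ι) (Y : ι → L), l.Nodup ∧ (∀ i, i ∈ l) ∧
      (∀ i, 0 < w i) ∧ (∀ i, w i < δ) ∧ (l.map w).sum = ‖A‖ + ‖B‖ ∧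
      energy w l Y = ‖A‖ + ‖B‖ ∧ expProd w l Y = exp (A : 𝔸) * exp (B : 𝔸) := by
  obtain ⟨m, hm⟩ := exists_nat_gt ((‖A‖ + ‖B‖) / δ)
  have hm₀ : (0 : ℝ) < m := (by positivity : (0 : ℝ) ≤ _).trans_lt hm
  let w : Fin m ⊕ Fin m → ℝ := Sum.elim (fun _ => ‖A‖ / m) fun _ => ‖B‖ / m
  let Y : Fin m ⊕ Fin m → L := Sum.elim (fun _ => ‖A‖⁻¹ • A) fun _ => ‖B‖⁻¹ • B
  let l : List (Fin m ⊕ Fin m) := (List.finRange m).map .inl ++ (List.finRange m).map .inr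
  refine ⟨Fin m ⊕ Fin m, w, l, Y, ?nodup, ?mem, ?pos, ?lt, ?duration, ?energy, ?prod⟩
  case nodup =>
    simp [l, List.nodup_append, List.nodup_map_iff, Sum.inl_injective, Sum.inr_injective,
      List.nodup_finRange]
  case mem => rintro (i | i) <;> simp [l]
  case pos => rintro (i | i) <;> simp only [w, Sum.elim_inl, Sum.elim_inr] <;> positivity
  case lt =>
    intro i
    have hle : w i ≤ (‖A‖ + ‖B‖) / m := by
      rcases i with i | i <;> simp only [w, Sum.elim_inl, Sum.elim_inr] <;> gcongr <;> simp
    exact hle.trans_lt ((div_lt_comm₀ hδ hm₀).1 hm)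
  case duration => simp [l, w, comp_def, mul_div_cancel₀ _ hm₀.ne']
  case energy =>
    simp [energy, l, w, Y, comp_def, norm_smul, hA, hB, mul_div_cancel₀ _ hm₀.ne']
  case prod =>
    have hpiece {X : L} (hX : X ≠ 0) :
        exp ((‖(X : 𝔸)‖ / m) • ‖(X : 𝔸)‖⁻¹ • (X : 𝔸)) ^ m = exp (X : 𝔸) := by
      have hnorm : ‖(X : 𝔸)‖ ≠ 0 := norm_ne_zero_iff.2 (mt ZeroMemClass.coe_eq_zero.1 hX)
      rw [smul_smul, div_mul_eq_mul_div, mul_inv_cancel₀ hnorm, one_div,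
        exp_inv_natCast_smul_pow (Nat.cast_ne_zero.1 hm₀.ne')]
    simp [expProd, l, w, Y, comp_def, hpiece, hA, hB]

theorem IsNormTraceOn.exists_exp_eq_exp_mul_exp (hτ : IsNormTraceOn L τ) (A B : L) :
    ∃ C : L, exp (C : 𝔸) = exp (A : 𝔸) * exp (B : 𝔸) ∧ ‖C‖ ≤ ‖A‖ + ‖B‖ := by
  rcases eq_or_ne A 0 with rfl | hA
  · exact ⟨B, by simp⟩
  rcases eq_or_ne B 0 with rfl | hB
  · exact ⟨A, by simp⟩
  have hpos : 0 < ‖A‖ + ‖B‖ := by positivity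
  obtain ⟨ε, hε, hunit⟩ := exists_pos_forall_isUnit_lieExpDifferential L
  obtain ⟨ι, w, l, Y, hnodup, hmem, hw, hwlt, hduration, henergy, hprod⟩ :=
    exists_expProd_eq_exp_mul_exp hA hB (δ := ε ^ 2 / (‖A‖ + ‖B‖)) (by positivity)
  have hsmall (i : ι) : w i * energy w l Y < ε ^ 2 := by
    rw [henergy]
    exact (lt_div_iff₀ hpos).1 (hwlt i)
  obtain ⟨V, hV, hVle⟩ := hτ.exists_exp_eq_expProd hε hunit hw hnodup hmem hsmall
  rw [hduration] at hV hVle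
  rw [henergy] at hVle
  have hVone : ‖V‖ ≤ 1 := by
    rw [← sq_le_one_iff₀ (norm_nonneg V)]
    exact le_of_mul_le_mul_left (hVle.trans_eq (mul_one _).symm) hpos
  refine ⟨(‖A‖ + ‖B‖) • V, hV.trans hprod, ?_⟩
  rw [norm_smul, Real.norm_of_nonneg hpos.le]
  exact mul_le_of_le_one_right hpos.le hVone

end BrokenGeodesic

/-- The skew-adjoint elements of a star algebra, as a Lie algebra under the commutator. -/
def skewAdjointLie (R A : Type*) [CommRing R] [StarRing R] [TrivialStar R] [Ring A] [StarRing A]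
    [Algebra R A] [StarModule R A] : LieSubalgebra R A where
  __ := skewAdjoint.submodule R A
  lie_mem' {x y} hx hy := by
    change star x = -x at hx
    change star y = -y at hy
    change star ⁅x, y⁆ = -⁅x, y⁆
    simp [Ring.lie_def, hx, hy]

section Matrix

variable {𝕜 n : Type*} [RCLike 𝕜] [Fintype n]

theorem frobenius_norm_sq_eq_neg_re_trace {X : Matrix n n 𝕜} (hX : Xᴴ = -X) :
    ‖X‖ ^ 2 = -RCLike.re (X * X).trace := by
  have hmul : -(X * X) = X * Xᴴ := by rw [hX, mul_neg]
  have hsum : ‖X‖ ^ 2 = ∑ i, ∑ j, ‖X i j‖ ^ 2 := by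
    rw [Matrix.frobenius_norm_def, ← Real.sqrt_eq_rpow, Real.sq_sqrt (by positivity)]
    simp
  rw [hsum, ← map_neg, ← Matrix.trace_neg, hmul]
  simp only [Matrix.trace, Matrix.diag_apply, Matrix.mul_apply, Matrix.conjTranspose_apply,
    RCLike.star_def, RCLike.mul_conj, map_sum]
  norm_cast

theorem lemma1_general [DecidableEq n] (A B : Matrix n n 𝕜) (hA : Aᴴ = -A) (hB : Bᴴ = -B) :
    ∃ C : Matrix n n 𝕜, Cᴴ = -C ∧ exp C = exp A * exp B ∧
      C ∈ LieSubalgebra.lieSpan ℝ (Matrix n n 𝕜) {A, B} ∧ ‖C‖ ≤ ‖A‖ + ‖B‖ := by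
  let : NormedRing (Matrix n n 𝕜) := Matrix.frobeniusNormedRing
  let : NormedAlgebra ℝ (Matrix n n 𝕜) := Matrix.frobeniusNormedAlgebra
  have : CompleteSpace (Matrix n n 𝕜) := FiniteDimensional.complete ℝ _
  let L := LieSubalgebra.lieSpan ℝ (Matrix n n 𝕜) {A, B}
  have : FiniteDimensional ℝ L := FiniteDimensional.finiteDimensional_submodule L.toSubmodule
  have hL : L ≤ skewAdjointLie ℝ (Matrix n n 𝕜) :=
    LieSubalgebra.lieSpan_le.2 (insert_subset hA (singleton_subset_iff.2 hB))
  let τ : Matrix n n 𝕜 →L[ℝ] ℝ :=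
    LinearMap.toContinuousLinearMap (RCLike.reLm ∘ₗ Matrix.traceLinearMap n ℝ 𝕜)
  have hτ : IsNormTraceOn L τ :=
    ⟨fun X Y => congrArg RCLike.re (Matrix.trace_mul_comm X Y),
      fun X hX => frobenius_norm_sq_eq_neg_re_trace (hL hX)⟩
  have hAL : A ∈ L := LieSubalgebra.subset_lieSpan (mem_insert A {B})
  have hBL : B ∈ L := LieSubalgebra.subset_lieSpan (mem_insert_of_mem A rfl)
  obtain ⟨C, hexp, hle⟩ := hτ.exists_exp_eq_exp_mul_exp ⟨A, hAL⟩ ⟨B, hBL⟩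
  exact ⟨C, hL C.2, hexp, C.2, hle⟩

end Matrix

theorem lemma1 {n : Type*} [Fintype n] [DecidableEq n] (A B : Matrix n n ℂ)
    (hA : Aᴴ = -A) (hB : Bᴴ = -B) :
    ∃ C : Matrix n n ℂ, Cᴴ = -C ∧
      NormedSpace.exp C = NormedSpace.exp A * NormedSpace.exp B ∧
      C ∈ LieSubalgebra.lieSpan ℝ (Matrix n n ℂ) {A, B} ∧
      ‖C‖ ≤ ‖A‖ + ‖B‖ :=
  lemma1_general A B hA hB
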